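/- Let $S$ be a set of $n$ points in $\mathbb{R}^2$, no three of which are collinear, and let $\kappa\colon S\to K$ be an assignment of colors from a set $K$ of $m$ colors in which every color is used. For an oriented segment $\sigma$ with two distinct endpoints $p,q\in S$, let $\sigma^+$ be the open half-plane on the positive (left) side of the line through $p$ and $q$ directed from $p$ to $q$; each pair of points thus determines two oriented segments, one for each side of its line. A color $i\in K$ is intersected by $\sigma^+$ if $\sigma^+$ contains a point $s\in S$ with $\kappa(s)=i$. For $c\in\{1,2\}$ and $j\ge 0$, the segment $\sigma$ is a $c$-chromatic (colored) $j$-facet if $|\{\kappa(p),\kappa(q)\}|=c$, exactly $j$ colors are intersected by $\sigma^+$, and neither $\kappa(p)$ nor $\kappa(q)$ is among them. Let $e_{c,j}(S)$ be the number of $c$-chromatic $j$-facets in $S$. Then for every integer $k$ with $0\le k\le m-2$, \[ (k+1)(k+2)\ \le\ \sum_{j=0}^{k} e_{2,j}(S)+\sum_{j=0}^{k}(k-j+1)\,e_{1,j}(S)\ \le\ (k+1)(2n-k-2). \] -/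

import Mathlib

namespace ColoredFacets

/-- The Euclidean plane. -/
abbrev Plane : Type := EuclideanSpace ℝ (Fin 2)

/-- No three distinct points of `S` lie on a common line. -/
def NoThreeCollinear (S : Finset Plane) : Prop :=
  ∀ p ∈ S, ∀ q ∈ S, ∀ r ∈ S, p ≠ q → p ≠ r → q ≠ r → ¬ Collinear ℝ ({p, q, r} : Set Plane)

/-- The open half-plane on the positive side of the segment oriented from `p` to `q`
(the points strictly to the left of the line directed from `p` to `q`). -/
def posSide (p q : Plane) : Set Plane :=
  {x | 0 < (q 0 - p 0) * (x 1 - p 1) - (q 1 - p 1) * (x 0 - p 0)}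

/-- The set of colors intersected by a subset `A` of the plane: those `i` such that `A` contains
a point of `S` of color `i`. -/
def colorsMet {S : Finset Plane} {m : ℕ} (κ : S → Fin m) (A : Set Plane) : Set (Fin m) :=
  {i | ∃ s : S, κ s = i ∧ (s : Plane) ∈ A}

/-- The set of `c`-chromatic colored `j`-facets of `S` with respect to `κ`. An oriented segment
with vertices in `S` is the ordered pair of its two distinct endpoints (so every two-point subset
carries two oriented segments, one for each side of its line). Its positive side intersects
exactly `j` colors, none of which is a color of an endpoint, and the endpoints have exactly `c`
different colors. -/
def coloredFacets {S : Finset Plane} {m : ℕ} (κ : S → Fin m) (c j : ℕ) : Set (S × S) :=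
  {σ | σ.1 ≠ σ.2 ∧
    Disjoint (colorsMet κ (posSide σ.1 σ.2)) {κ σ.1, κ σ.2} ∧
    (colorsMet κ (posSide σ.1 σ.2)).ncard = j ∧
    ({κ σ.1, κ σ.2} : Set (Fin m)).ncard = c}

/-- The number `e_{c,j}(S)` of `c`-chromatic colored `j`-facets. -/
noncomputable def numFacets {S : Finset Plane} {m : ℕ} (κ : S → Fin m) (c j : ℕ) : ℕ :=
  (coloredFacets κ c j).ncard

end ColoredFacets

/-!
Let `s` be a vertex of the convex hull, and order the other points by slope as seen from `s`. The
positive side of a segment at `s` then consists of the points on one side of its other endpoint in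
this order, so the weights of the segments starting at `s` telescope: their total is exactly
`K = k + 1`, and so is that of the segments ending at `s`, as long as the color of `s` or at least
`K` colors occur among the other points.

Upper bound: deleting `s` can only increase the weight of the remaining segments; induct on the
number of points. Lower bound: deleting the whole color class of `s` lowers the level of a remaining
segment by at most one, so the weights up to level `K + 1` before dominate those up to level `K`
after; induct on `K`.
-/

namespace ColoredFacets

open Finset
open scoped RealInnerProductSpace

lemma two_mul_sum_range_sub {K m : ℕ} (h : K ≤ m) :
    2 * ∑ i ∈ range m, (K - i) = K * (K + 1) := by
  induction K generalizing m with
  | zero => simp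
  | succ K ih =>
    obtain ⟨m, rfl⟩ := Nat.exists_eq_succ_of_ne_zero (Nat.ne_zero_of_lt h)
    simp only [sum_range_succ', Nat.add_sub_add_right, Nat.sub_zero, mul_add,
      ih (Nat.succ_le_succ_iff.1 h)]
    ring

lemma sum_offDiag_eq_erase_add {α M : Type*} [DecidableEq α] [AddCommMonoid M] {T : Finset α}
    {s : α} (hs : s ∈ T) (f : α × α → M) :
    ∑ σ ∈ T.offDiag, f σ =
      ∑ σ ∈ (T.erase s).offDiag, f σ + ∑ q ∈ T.erase s, (f (s, q) + f (q, s)) := by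
  have hs' := notMem_erase s T
  conv_lhs => rw [← insert_erase hs, offDiag_insert hs']
  rw [sum_union (by rw [disjoint_left]; grind), sum_union (by rw [disjoint_left]; grind),
    sum_product, sum_singleton, sum_product_right, sum_singleton, sum_add_distrib, add_assoc]

lemma exists_inner_lt_inner_self {E : Type*} [NormedAddCommGroup E] [InnerProductSpace ℝ E]
    {T : Finset E} (hT : T.Nonempty) : ∃ s ∈ T, ∀ p ∈ T, p ≠ s → ⟪s, p⟫ < ⟪s, s⟫ := by
  obtain ⟨s, hs, hmax⟩ := T.exists_max_image norm hT
  refine ⟨s, hs, fun p hp hps => ?_⟩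
  have hdist : 0 < ‖s - p‖ ^ 2 := by
    have := sub_ne_zero.2 hps.symm
    positivity
  have hnorm : ‖p‖ ^ 2 ≤ ‖s‖ ^ 2 := by gcongr; exact hmax p hp
  rw [norm_sub_sq_real] at hdist
  rw [real_inner_self_eq_norm_sq]
  linarith

section Weight

variable {ι : Type*} [DecidableEq ι]

/-- The contribution to the facet sum below level `K` of an oriented segment with endpoint colors
`a`, `b` whose positive side meets exactly the colors in `M`: a bichromatic `j`-facet counts once
if `j < K`, a monochromatic one counts `K - j` times (truncated at `0`), and a segment that is not
a colored facet does not count. -/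
def facetWeight (K : ℕ) (a b : ι) (M : Finset ι) : ℕ :=
  if a ∉ M ∧ b ∉ M then if a = b then K - #M else if #M < K then 1 else 0 else 0

lemma facetWeight_comm (K : ℕ) (a b : ι) (M : Finset ι) :
    facetWeight K a b M = facetWeight K b a M := by
  simp only [facetWeight, and_comm, eq_comm]

lemma facetWeight_anti (K : ℕ) (a b : ι) {M N : Finset ι} (h : M ⊆ N) :
    facetWeight K a b N ≤ facetWeight K a b M := by
  have hcard := card_le_card h
  have ha : a ∈ M → a ∈ N := @h a
  have hb : b ∈ M → b ∈ N := @h b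
  unfold facetWeight
  split_ifs <;> first | omega | tauto

lemma facetWeight_erase_le (K : ℕ) {a b c : ι} (ha : a ≠ c) (hb : b ≠ c) (M : Finset ι) :
    facetWeight K a b (M.erase c) ≤ facetWeight (K + 1) a b M := by
  have hcard := pred_card_le_card_erase (s := M) (a := c)
  simp only [facetWeight, mem_erase, ha, hb, ne_eq, not_false_eq_true, true_and]
  split_ifs <;> omega

lemma facetWeight_eq_sum (K : ℕ) (a b : ι) (M : Finset ι) :
    facetWeight K a b M =
      ∑ j ∈ range K, (if a ∉ M ∧ b ∉ M ∧ #M = j ∧ #{a, b} = 2 then 1 else 0) +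
        ∑ j ∈ range K, (K - j) * if a ∉ M ∧ b ∉ M ∧ #M = j ∧ #{a, b} = 1 then 1 else 0 := by
  by_cases hM : a ∉ M ∧ b ∉ M
  · obtain rfl | hab := eq_or_ne a b
    · simpa [facetWeight, hM.1] using Nat.sub_eq_zero_of_le
    · simp [facetWeight, hM, hab, card_pair hab]
  · have hcond (P : Prop) : ¬(a ∉ M ∧ b ∉ M ∧ P) := fun h => hM ⟨h.1, h.2.1⟩
    simp [facetWeight, hM, hcond]

/-- Each new color seen from the top of the order uses up one unit of the budget `K`, until the
color `a` itself shows up and takes all that remains. -/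
lemma sum_facetWeight_image_gt {α β : Type*} [LinearOrder β] (κ : α → ι) (a : ι) (K : ℕ)
    {R : Finset α} {h : α → β} (hinj : Set.InjOn h R) :
    ∑ q ∈ R, facetWeight K a (κ q) ({r ∈ R | h q < h r}.image κ) +
      (if a ∈ R.image κ then 0 else K - #(R.image κ)) = K := by
  classical
  induction R using Finset.induction_on_min_value h with
  | empty => simp
  | insert p R hp hmin ih =>
    have hlt : ∀ r ∈ R, h p < h r := fun r hr => (hmin r hr).lt_of_ne fun e =>
      hp (hinj (mem_coe.2 (mem_insert_self p R)) (mem_coe.2 (mem_insert_of_mem hr)) e ▸ hr)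
    have habove_p : {r ∈ insert p R | h p < h r} = R := by
      rw [filter_insert, if_neg (lt_irrefl _), filter_true_of_mem hlt]
    have habove : ∀ q ∈ R, {r ∈ insert p R | h q < h r} = {r ∈ R | h q < h r} := fun q hq => by
      rw [filter_insert, if_neg (not_lt.2 (hmin q hq))]
    have hstep : facetWeight K a (κ p) (R.image κ) +
        (if a ∈ (insert p R).image κ then 0 else K - #((insert p R).image κ)) =
          if a ∈ R.image κ then 0 else K - #(R.image κ) := by
      rw [image_insert]
      unfold facetWeight
      by_cases hpR : κ p ∈ R.image κ
      · simp only [insert_eq_of_mem hpR, hpR, not_true_eq_false, and_false, if_false, zero_add]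
      · simp only [mem_insert, card_insert_of_notMem hpR, hpR, not_false_eq_true, and_true]
        split_ifs <;> first | omega | tauto
    rw [sum_insert hp, habove_p, sum_congr rfl fun q hq => by rw [habove q hq], add_right_comm,
      hstep, add_comm]
    exact ih (hinj.mono (coe_subset.2 (subset_insert p R)))

end Weight

section Geometry

lemma inner_plane (u w : Plane) : ⟪u, w⟫ = u 0 * w 0 + u 1 * w 1 := by
  rw [PiLp.inner_apply, Fin.sum_univ_two, Real.inner_apply, Real.inner_apply]

/-- Twice the signed area of the triangle `p q r`. -/
def cross (p q r : Plane) : ℝ :=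
  (q 0 - p 0) * (r 1 - p 1) - (q 1 - p 1) * (r 0 - p 0)

lemma mem_posSide {p q r : Plane} : r ∈ posSide p q ↔ 0 < cross p q r := Iff.rfl

lemma cross_swap_left (p q r : Plane) : cross q p r = -cross p q r := by
  unfold cross; ring

lemma cross_swap_right (p q r : Plane) : cross p r q = -cross p q r := by
  unfold cross; ring

lemma left_notMem_posSide (p q : Plane) : p ∉ posSide p q := by
  simp [mem_posSide, cross]

lemma right_notMem_posSide (p q : Plane) : q ∉ posSide p q := by
  simp [mem_posSide, cross, mul_comm]

lemma collinear_of_cross_eq_zero {p q r : Plane} (h : cross p q r = 0) :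
    Collinear ℝ {p, q, r} := by
  obtain rfl | hpq := eq_or_ne p q
  · simpa using collinear_pair ℝ p r
  have hnorm : ‖q - p‖ ^ 2 ≠ 0 := pow_ne_zero 2 (norm_ne_zero_iff.2 (sub_ne_zero.2 hpq.symm))
  have hr : r = (⟪q - p, r - p⟫ / ‖q - p‖ ^ 2) • (q - p) + p := by
    rw [← sub_eq_iff_eq_add, div_eq_inv_mul, mul_smul, eq_inv_smul_iff₀ hnorm]
    unfold cross at h
    refine PiLp.ext (Fin.forall_fin_two.2 ⟨?_, ?_⟩) <;>
      simp only [← real_inner_self_eq_norm_sq, inner_plane, PiLp.smul_apply, PiLp.sub_apply,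
        smul_eq_mul]
    · linear_combination (-(q 1 - p 1)) * h
    · linear_combination (q 0 - p 0) * h
  rw [collinear_iff_of_mem (p₀ := p) (by simp)]
  refine ⟨q - p, ?_⟩
  rintro z (rfl | rfl | rfl)
  exacts [⟨0, by simp⟩, ⟨1, by simp⟩, ⟨_, hr⟩]

/-- The slope of the line `sp` in coordinates whose first axis points in direction `-v`. It orders
by angle around `s` the points on the side `⟪v, p⟫ < ⟪v, s⟫`; on the line `⟪v, p⟫ = ⟪v, s⟫`
it has the junk value `0`. -/
noncomputable def slopeFrom (v s p : Plane) : ℝ :=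
  (v 1 * (p 0 - s 0) - v 0 * (p 1 - s 1)) / ⟪v, s - p⟫

variable {v s p q : Plane}

lemma cross_pos_iff_slopeFrom_lt (hp : ⟪v, p⟫ < ⟪v, s⟫) (hq : ⟪v, q⟫ < ⟪v, s⟫) :
    0 < cross s p q ↔ slopeFrom v s p < slopeFrom v s q := by
  have hv : 0 < ‖v‖ ^ 2 := by
    have : v ≠ 0 := by rintro rfl; simp at hp
    positivity
  have hkey : ‖v‖ ^ 2 * cross s p q =
      (v 1 * (q 0 - s 0) - v 0 * (q 1 - s 1)) * ⟪v, s - p⟫ -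
        (v 1 * (p 0 - s 0) - v 0 * (p 1 - s 1)) * ⟪v, s - q⟫ := by
    simp only [cross, ← real_inner_self_eq_norm_sq, inner_plane, PiLp.sub_apply]
    ring
  rw [← sub_pos, ← inner_sub_right] at hp hq
  rw [slopeFrom, slopeFrom, div_lt_div_iff₀ hp hq, ← sub_pos (b := _ * ⟪v, s - q⟫), ← hkey,
    mul_pos_iff_of_pos_left hv]

lemma cross_neg_iff_slopeFrom_lt (hp : ⟪v, p⟫ < ⟪v, s⟫) (hq : ⟪v, q⟫ < ⟪v, s⟫) :
    cross s p q < 0 ↔ slopeFrom v s q < slopeFrom v s p := by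
  rw [← cross_pos_iff_slopeFrom_lt hq hp, cross_swap_right, Left.neg_neg_iff]

lemma NoThreeCollinear.mono {S T : Finset Plane} (hT : NoThreeCollinear T) (h : S ⊆ T) :
    NoThreeCollinear S :=
  fun p hp q hq r hr => hT p (h hp) q (h hq) r (h hr)

lemma NoThreeCollinear.injOn_slopeFrom {T : Finset Plane} (hT : NoThreeCollinear T) (hsT : s ∈ T)
    (hs : ∀ p ∈ T.erase s, ⟪v, p⟫ < ⟪v, s⟫) : Set.InjOn (slopeFrom v s) (T.erase s) := by
  intro p hp q hq hpq
  rw [mem_coe] at hp hq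
  by_contra hne
  refine hT s hsT p (mem_of_mem_erase hp) q (mem_of_mem_erase hq) (ne_of_mem_erase hp).symm
    (ne_of_mem_erase hq).symm hne (collinear_of_cross_eq_zero (le_antisymm ?_ ?_))
  · rw [← not_lt, cross_pos_iff_slopeFrom_lt (hs p hp) (hs q hq)]
    exact hpq.not_lt
  · rw [← not_lt, cross_neg_iff_slopeFrom_lt (hs p hp) (hs q hq)]
    exact hpq.not_gt

end Geometry

section FacetSum

variable {ι : Type*} [DecidableEq ι] (κ : Plane → ι) {S T : Finset Plane} {s v : Plane}

open Classical in
/-- The colors of the points of `T` on the positive side of the segment from `p` to `q`: a finset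
version of `colorsMet` for a coloring of the whole plane, so that `T` can vary. -/
noncomputable def met (T : Finset Plane) (p q : Plane) : Finset ι :=
  {r ∈ T | r ∈ posSide p q}.image κ

/-- The contribution to `facetSum` of the segment from `p` to `q`. -/
noncomputable def segmentWeight (T : Finset Plane) (K : ℕ) (p q : Plane) : ℕ :=
  facetWeight K (κ p) (κ q) (met κ T p q)

/-- The weighted number of colored facets of `T` below level `K`. With `K = k + 1` this is the sum
bounded in the theorem. -/
noncomputable def facetSum (T : Finset Plane) (K : ℕ) : ℕ :=
  ∑ σ ∈ T.offDiag, segmentWeight κ T K σ.1 σ.2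

lemma met_mono (h : S ⊆ T) (p q : Plane) : met κ S p q ⊆ met κ T p q := by
  unfold met
  gcongr

lemma met_filter_color_ne (T : Finset Plane) (a : ι) (p q : Plane) :
    met κ {r ∈ T | κ r ≠ a} p q = (met κ T p q).erase a := by
  ext c
  simp only [met, mem_image, mem_filter, mem_erase]
  grind

lemma met_extreme_left (hs : ∀ p ∈ T.erase s, ⟪v, p⟫ < ⟪v, s⟫) {q : Plane} (hq : q ∈ T.erase s) :
    met κ T s q = {r ∈ T.erase s | slopeFrom v s q < slopeFrom v s r}.image κ := by
  unfold met
  congr 1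
  ext r
  obtain rfl | hrs := eq_or_ne r s
  · simp [left_notMem_posSide]
  · simp only [mem_filter, mem_erase, hrs, ne_eq, not_false_eq_true, true_and, mem_posSide]
    exact and_congr_right fun hr =>
      cross_pos_iff_slopeFrom_lt (hs q hq) (hs r (mem_erase.2 ⟨hrs, hr⟩))

lemma met_extreme_right (hs : ∀ p ∈ T.erase s, ⟪v, p⟫ < ⟪v, s⟫) {q : Plane} (hq : q ∈ T.erase s) :
    met κ T q s = {r ∈ T.erase s | slopeFrom v s r < slopeFrom v s q}.image κ := by
  unfold met
  congr 1
  ext r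
  obtain rfl | hrs := eq_or_ne r s
  · simp [right_notMem_posSide]
  · simp only [mem_filter, mem_erase, hrs, ne_eq, not_false_eq_true, true_and, mem_posSide,
      cross_swap_left s q, neg_pos]
    exact and_congr_right fun hr =>
      cross_neg_iff_slopeFrom_lt (hs q hq) (hs r (mem_erase.2 ⟨hrs, hr⟩))

lemma sum_segmentWeight_extreme (hT : NoThreeCollinear T) (hsT : s ∈ T)
    (hs : ∀ p ∈ T.erase s, ⟪v, p⟫ < ⟪v, s⟫) (K : ℕ) :
    ∑ q ∈ T.erase s, (segmentWeight κ T K s q + segmentWeight κ T K q s) +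
      2 * (if κ s ∈ (T.erase s).image κ then 0 else K - #((T.erase s).image κ)) = 2 * K := by
  have hinj := hT.injOn_slopeFrom hsT hs
  have hleft := sum_facetWeight_image_gt κ (κ s) K hinj
  have hright := sum_facetWeight_image_gt κ (κ s) K (OrderDual.toDual.injective.comp_injOn hinj)
  have hstart : ∀ q ∈ T.erase s, segmentWeight κ T K s q = facetWeight K (κ s) (κ q)
      ({r ∈ T.erase s | slopeFrom v s q < slopeFrom v s r}.image κ) := fun q hq => by
    rw [segmentWeight, met_extreme_left κ hs hq]
  have hend : ∀ q ∈ T.erase s, segmentWeight κ T K q s = facetWeight K (κ s) (κ q)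
      ({r ∈ T.erase s | slopeFrom v s r < slopeFrom v s q}.image κ) := fun q hq => by
    rw [segmentWeight, facetWeight_comm, met_extreme_right κ hs hq]
  simp only [Function.comp_apply, OrderDual.toDual_lt_toDual] at hright
  rw [sum_add_distrib, sum_congr rfl hstart, sum_congr rfl hend]
  linarith

lemma segmentWeight_anti (h : S ⊆ T) (K : ℕ) (p q : Plane) :
    segmentWeight κ T K p q ≤ segmentWeight κ S K p q :=
  facetWeight_anti K _ _ (met_mono κ h p q)

lemma facetSum_filter_color_ne_le (T : Finset Plane) (K : ℕ) (a : ι) :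
    facetSum κ {r ∈ T | κ r ≠ a} K ≤
      ∑ σ ∈ {r ∈ T | κ r ≠ a}.offDiag, segmentWeight κ T (K + 1) σ.1 σ.2 := by
  refine sum_le_sum fun σ hσ => ?_
  rw [mem_offDiag, mem_filter, mem_filter] at hσ
  rw [segmentWeight, met_filter_color_ne]
  exact facetWeight_erase_le K hσ.1.2 hσ.2.1.2 _

theorem facetSum_add_le (hT : NoThreeCollinear T) (K : ℕ) :
    facetSum κ T K + 2 * ∑ i ∈ range #(T.image κ), (K - i) ≤ 2 * K * #T := by
  induction hn : #T generalizing T with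
  | zero => simp [card_eq_zero.1 hn, facetSum]
  | succ n ih =>
    obtain ⟨s, hsT, hs⟩ := exists_inner_lt_inner_self (card_pos.1 (n.succ_pos.trans_eq hn.symm))
    have hstar := sum_segmentWeight_extreme κ hT hsT
      (fun p hp => hs p (mem_of_mem_erase hp) (ne_of_mem_erase hp)) K
    have hrest : facetSum κ (T.erase s) K + _ ≤ _ :=
      ih (hT.mono (erase_subset s T)) (by rw [card_erase_of_mem hsT, hn, Nat.add_sub_cancel])
    have hsplit : facetSum κ T K ≤ facetSum κ (T.erase s) K +
        ∑ q ∈ T.erase s, (segmentWeight κ T K s q + segmentWeight κ T K q s) := by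
      rw [facetSum, sum_offDiag_eq_erase_add hsT]
      gcongr with σ
      exact sum_le_sum fun σ _ => segmentWeight_anti κ (erase_subset s T) K _ _
    have hcolors : ∑ i ∈ range #(T.image κ), (K - i) =
        ∑ i ∈ range #((T.erase s).image κ), (K - i) +
          if κ s ∈ (T.erase s).image κ then 0 else K - #((T.erase s).image κ) := by
      conv_lhs => rw [← insert_erase hsT, image_insert]
      split_ifs with hmem
      · rw [insert_eq_of_mem hmem, add_zero]
      · rw [card_insert_of_notMem hmem, sum_range_succ]
    linarith

theorem le_facetSum (hT : NoThreeCollinear T) {K : ℕ} (hK : K + 1 ≤ #(T.image κ)) :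
    K * (K + 1) ≤ facetSum κ T K := by
  induction K generalizing T with
  | zero => simp
  | succ K ih =>
    obtain ⟨s, hsT, hs⟩ := exists_inner_lt_inner_self
      (image_nonempty.1 (card_pos.1 (Nat.zero_lt_of_lt hK)))
    have hsub : {r ∈ T | κ r ≠ κ s} ⊆ T.erase s := by grind
    have hcolors : K + 1 ≤ #({r ∈ T | κ r ≠ κ s}.image κ) := by
      have himage : {r ∈ T | κ r ≠ κ s}.image κ = (T.image κ).erase (κ s) := by grind
      rw [himage, card_erase_of_mem (mem_image_of_mem κ hsT)]
      omega
    have hstar : ∑ q ∈ T.erase s, (segmentWeight κ T (K + 1) s q + segmentWeight κ T (K + 1) q s) =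
        2 * (K + 1) := by
      have hdeficit : K + 1 - #((T.erase s).image κ) = 0 :=
        Nat.sub_eq_zero_of_le (hcolors.trans (card_le_card (image_subset_image hsub)))
      simpa only [hdeficit, ite_self, mul_zero, add_zero] using sum_segmentWeight_extreme κ hT hsT
        (fun p hp => hs p (mem_of_mem_erase hp) (ne_of_mem_erase hp)) (K + 1)
    calc (K + 1) * (K + 1 + 1) = K * (K + 1) + 2 * (K + 1) := by ring
      _ ≤ facetSum κ {r ∈ T | κ r ≠ κ s} K + 2 * (K + 1) := by
        gcongr
        exact ih (hT.mono (filter_subset _ T)) hcolors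
      _ ≤ ∑ σ ∈ {r ∈ T | κ r ≠ κ s}.offDiag, segmentWeight κ T (K + 1) σ.1 σ.2 + 2 * (K + 1) := by
        gcongr
        exact facetSum_filter_color_ne_le κ T K (κ s)
      _ ≤ ∑ σ ∈ (T.erase s).offDiag, segmentWeight κ T (K + 1) σ.1 σ.2 + 2 * (K + 1) := by
        gcongr
      _ = facetSum κ T (K + 1) := by
        rw [facetSum, sum_offDiag_eq_erase_add hsT, hstar]

end FacetSum

section NumFacets

variable {S : Finset Plane} {m : ℕ} (κ : Plane → Fin m)

lemma colorsMet_comp_val (p q : Plane) :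
    colorsMet (κ ∘ Subtype.val : S → Fin m) (posSide p q) = met κ S p q := by
  ext i
  simp only [colorsMet, met, Function.comp_apply, Subtype.exists, exists_prop, Set.mem_ofPred_eq,
    mem_coe, mem_image, mem_filter]
  grind

lemma numFacets_comp_val (c j : ℕ) :
    numFacets (κ ∘ Subtype.val : S → Fin m) c j =
      ∑ σ ∈ S.offDiag, if κ σ.1 ∉ met κ S σ.1 σ.2 ∧ κ σ.2 ∉ met κ S σ.1 σ.2 ∧
        #(met κ S σ.1 σ.2) = j ∧ #{κ σ.1, κ σ.2} = c then 1 else 0 := by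
  have hinj : Function.Injective (Prod.map Subtype.val Subtype.val : S × S → Plane × Plane) :=
    Subtype.val_injective.prodMap Subtype.val_injective
  have hpair (i i' : Fin m) : ({i, i'} : Set (Fin m)).ncard = #{i, i'} := by
    rw [← coe_pair, Set.ncard_coe_finset]
  rw [← card_filter, ← Set.ncard_coe_finset, numFacets, ← Set.ncard_image_of_injective _ hinj]
  congr 1
  ext ⟨p, q⟩
  simp only [coloredFacets, colorsMet_comp_val, hpair, Function.comp_apply,
    Set.disjoint_insert_right, Set.disjoint_singleton_right, mem_coe, Set.ncard_coe_finset,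
    Set.mem_image, Set.mem_ofPred_eq, Prod.exists, Prod.map_apply, Prod.mk.injEq, Subtype.exists,
    mem_filter, mem_offDiag]
  grind

lemma facetSum_eq_sum_numFacets (K : ℕ) :
    facetSum κ S K = ∑ j ∈ range K, numFacets (κ ∘ Subtype.val : S → Fin m) 2 j +
      ∑ j ∈ range K, (K - j) * numFacets (κ ∘ Subtype.val : S → Fin m) 1 j := by
  simp only [facetSum, segmentWeight, facetWeight_eq_sum, sum_add_distrib, numFacets_comp_val,
    mul_sum]
  rw [sum_comm, sum_comm (s := S.offDiag)]

lemma cast_facetSum_succ (k : ℕ) :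
    (facetSum κ S (k + 1) : ℤ) =
      ∑ j ∈ range (k + 1), (numFacets (κ ∘ Subtype.val : S → Fin m) 2 j : ℤ) +
        ∑ j ∈ range (k + 1),
          ((k : ℤ) - j + 1) * (numFacets (κ ∘ Subtype.val : S → Fin m) 1 j : ℤ) := by
  rw [facetSum_eq_sum_numFacets]
  push_cast
  congr 1
  refine sum_congr rfl fun j hj => ?_
  rw [Nat.cast_sub (mem_range.1 hj).le]
  push_cast
  ring

end NumFacets

end ColoredFacets

theorem mainTheorem10 (n m : ℕ) (S : Finset ColoredFacets.Plane) (hn : S.card = n)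
    (hS : ColoredFacets.NoThreeCollinear S)
    (κ : S → Fin m) (hκ : Function.Surjective κ)
    (k : ℕ) (hk : k + 2 ≤ m) :
    ((k : ℤ) + 1) * ((k : ℤ) + 2) ≤
        ∑ j ∈ Finset.range (k + 1), (ColoredFacets.numFacets κ 2 j : ℤ) +
          ∑ j ∈ Finset.range (k + 1), ((k : ℤ) - (j : ℤ) + 1) * (ColoredFacets.numFacets κ 1 j : ℤ) ∧
      ∑ j ∈ Finset.range (k + 1), (ColoredFacets.numFacets κ 2 j : ℤ) +
          ∑ j ∈ Finset.range (k + 1), ((k : ℤ) - (j : ℤ) + 1) * (ColoredFacets.numFacets κ 1 j : ℤ) ≤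
        ((k : ℤ) + 1) * (2 * (n : ℤ) - (k : ℤ) - 2) := by
  have : Nonempty (Fin m) := ⟨⟨0, by omega⟩⟩
  obtain ⟨κ, rfl⟩ := Subtype.val_injective.surjective_comp_right κ
  have hcolors : (S.image κ).card = m := by
    have himage : S.image κ = Finset.univ := Finset.eq_univ_of_forall fun i => by
      obtain ⟨p, hp⟩ := hκ i
      exact Finset.mem_image.2 ⟨p, p.2, hp⟩
    rw [himage, Finset.card_fin]
  have hlower := ColoredFacets.le_facetSum κ hS (K := k + 1) (hk.trans_eq hcolors.symm)
  have hupper := ColoredFacets.facetSum_add_le κ hS (k + 1)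
  rw [hcolors, ColoredFacets.two_mul_sum_range_sub (by omega), hn] at hupper
  zify at hlower hupper
  rw [ColoredFacets.cast_facetSum_succ] at hlower hupper
  constructor <;> linarith
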